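/- There are absolute constants $P$, $a$, $c$ such that for every $\varepsilon\in(0,1]$ there is a constant $C=C(\varepsilon)>0$ with the following property. Let $n,m,r$ be integers with $1\le r\le \log m$ (natural logarithm). There is a randomized multi-pass streaming algorithm for set cover instances with $n$ sets over a ground set of $m$ elements, in the edge-arrival model, which makes at most $P\,r$ passes over the stream and whose memory consists of one mark bit for each of the $m$ elements, cells that hold one edge each, and a binary work space, where the number of edge cells plus the number of bits of work space is at most $$ C\, n\, m^{\frac{3}{2+r}}\,(\log (nm))^{c}=\tilde O\bigl(n\,m^{\frac{3}{2+r}}\bigr), $$ and also at most $C\, n\, m^{a/r}\,(\log (nm))^{c}=\tilde O\bigl(n\,m^{O(1/r)}\bigr)$. For every family of $n$ subsets of the ground set in which each element lies in at least one set, and for every order in which the edges (the pairs (set, element) with the element in the set) arrive, the algorithm outputs with probability at least $1-\frac1n$ a $(1+\varepsilon)\log m$-approximate set cover, that is, a subfamily that covers all $m$ elements and has at most $(1+\varepsilon)\log m$ times as many sets as a minimum set cover. Here an edge-arrival stream lists every edge exactly once. In every pass, the algorithm reads the whole stream (in the same order); on each edge, and at the end of each pass, the contents of the memory are updated at random, with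 a law that depends only on the number of the pass, the current contents of the memory and the arriving edge, so that random choices needed later have to be stored. The algorithm may depend on $n,m,r,\varepsilon$, but not on the family or on the order of the edges. -/

import Mathlib

namespace EdgeArrival

/-- An edge of the bipartite graph of a coverage instance with `n` sets and `m` elements:
`(i, e)` says that element `e` belongs to set `i`. -/
abbrev Edge (n m : ℕ) : Type := Fin n × Fin m

/-- `S` is (the index set of) a set cover of the family `F`: every element of the ground set
`Fin m` lies in one of the chosen sets. -/
def IsSetCover {n m : ℕ} (F : Fin n → Finset (Fin m)) (S : Finset (Fin n)) : Prop :=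
  ∀ e : Fin m, ∃ i ∈ S, e ∈ F i

/-- `S` is an `α`-approximate solution to set cover: it is a set cover, and its size is at most
`α` times the size of every set cover, hence at most `α` times the minimum size. -/
def IsApproxSetCover {n m : ℕ} (α : ℝ) (F : Fin n → Finset (Fin m)) (S : Finset (Fin n)) : Prop :=
  IsSetCover F S ∧ ∀ T : Finset (Fin n), IsSetCover F T → (S.card : ℝ) ≤ α * (T.card : ℝ)

/-- `σ` is an edge-arrival stream of `F`: it lists every edge of the bipartite graph of `F`
exactly once, in an arbitrary order. -/
def IsEdgeStream {n m : ℕ} (F : Fin n → Finset (Fin m)) (σ : List (Edge n m)) : Prop :=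
  σ.Nodup ∧ ∀ (i : Fin n) (e : Fin m), (i, e) ∈ σ ↔ e ∈ F i

/-- The contents of the memory: `B` cells, each empty or holding one edge; one mark bit per
element of the ground set; and `w` further bits of work space. -/
@[ext]
structure Memory (n m B w : ℕ) : Type where
  cells : Fin B → Option (Edge n m)
  marks : Fin m → Bool
  work : Fin w → Bool

/-- A randomized multi-pass streaming algorithm for instances with `n` sets and `m` elements.
All that is carried from one stream item to the next, or from one pass to the next, is the
memory: fresh randomness may be used at each transition, but a random choice that is needed
again later has to be kept in the memory. -/
structure StreamingAlgorithm (n m : ℕ) : Type where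
  /-- number of passes over the stream -/
  passes : ℕ
  /-- number of memory cells for edges -/
  edgeCells : ℕ
  /-- number of bits of work space -/
  workBits : ℕ
  /-- law of the initial memory -/
  init : PMF (Memory n m edgeCells workBits)
  /-- update of the memory in a given pass on the arrival of an edge -/
  step : ℕ → Memory n m edgeCells workBits → Edge n m → PMF (Memory n m edgeCells workBits)
  /-- update of the memory at the end of a given pass -/
  endPass : ℕ → Memory n m edgeCells workBits → PMF (Memory n m edgeCells workBits)
  /-- the sets reported after the last pass -/
  report : Memory n m edgeCells workBits → Finset (Fin n)

/-- Process a list of items from left to right by a random transition. -/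
noncomputable def consume {M E : Type} (f : M → E → PMF M) : List E → M → PMF M
  | [], s => PMF.pure s
  | e :: σ, s => (f s e).bind (consume f σ)

namespace StreamingAlgorithm

variable {n m : ℕ}

/-- The law of the memory after the first `j` passes over the stream `σ`. -/
noncomputable def afterPasses (A : StreamingAlgorithm n m) (σ : List (Edge n m)) :
    ℕ → PMF (Memory n m A.edgeCells A.workBits)
  | 0 => A.init
  | j + 1 => (A.afterPasses σ j).bind fun s => (consume (A.step j) σ s).bind (A.endPass j)

/-- The law of the reported family of sets on the stream `σ`. -/
noncomputable def output (A : StreamingAlgorithm n m) (σ : List (Edge n m)) :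
    PMF (Finset (Fin n)) :=
  (A.afterPasses σ A.passes).map A.report

/-- Edge cells plus bits of work space (the `m` mark bits are not counted here). -/
def space (A : StreamingAlgorithm n m) : ℕ := A.edgeCells + A.workBits

end StreamingAlgorithm

end EdgeArrival

/-! The cover is built in `r` rounds of element sampling. With high probability, a round chooses a
family at most `1 + ε` times as large as the optimum `k` and leaves uncovered at most a fraction `1
/ (2 * m ^ (1 / r))` of the unmarked elements. After `r` rounds fewer than one element remains, and
`r ≤ log m` bounds the total size.

Since `k` is unknown, a family `T` is tested only on the first `q * #T` of `n * q` samples. If `T`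
leaves more than a fraction `λ` uncovered, it covers these samples with probability at most `y ^
#T`, where `y = exp (-λ * q)`; a union bound over all nonempty `T` gives `(1 + y) ^ n - 1`
(`sampleLaw_exists_le`).

Storing every set that contains a sample could take `n ^ 2 * q` indices. Instead the `t`-th sample
keeps about `K * n * q / (t + 1)` of them, a harmonic sum of order `K * n * q * log (n * q)` in all.
A full bucket that a family of at most `2 * k` sets has to hit holds at least `K * n / (2 * k)`
sets, so some `ε * k` sets hit all such buckets (`exists_hitting_set`). Together with an optimal
cover they pass the test (`exists_hits`), so the smallest family that passes has at most `(1 + ε) *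
k` sets.

The space is `n * m ^ (1 / r)` up to logarithms, and `1 / r ≤ 3 / (2 + r)`. -/

namespace EdgeArrival

/-! ### Simulating a chain of abstract states inside the memory -/

section Simulation

theorem consume_pure_map {S M E : Type} (enc : S → M) (dec : M → S)
    (h : Function.LeftInverse dec enc) (g : S → E → S) (σ : List E) (s : S) :
    consume (fun s e => PMF.pure (enc (g (dec s) e))) σ (enc s) =
      PMF.pure (enc (σ.foldl g s)) := by
  induction σ generalizing s with
  | nil => rfl
  | cons e σ ih => simp only [consume, PMF.pure_bind, h s, ih, List.foldl_cons]

/-- The law of the state after `j` passes, for an algorithm that updates its state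
deterministically by `g` on each edge and randomly by `fin` at the end of each pass. -/
noncomputable def passLaw {S E : Type} (s₀ : S) (g : ℕ → S → E → S) (fin : ℕ → S → PMF S)
    (σ : List E) : ℕ → PMF S
  | 0 => PMF.pure s₀
  | j + 1 => (passLaw s₀ g fin σ j).bind fun s => fin j (σ.foldl (g j) s)

/-- A streaming algorithm that keeps its state encoded in the memory. -/
noncomputable def encoded {n m B w : ℕ} {S : Type} (enc : S → Memory n m B w)
    (dec : Memory n m B w → S) (p : ℕ) (s₀ : S) (g : ℕ → S → Edge n m → S)
    (fin : ℕ → S → PMF S) (rep : S → Finset (Fin n)) : StreamingAlgorithm n m where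
  passes := p
  edgeCells := B
  workBits := w
  init := PMF.pure (enc s₀)
  step j s e := PMF.pure (enc (g j (dec s) e))
  endPass j s := (fin j (dec s)).map enc
  report s := rep (dec s)

/-- Reduces the analysis to the chain `passLaw` on abstract states: decoding undoes encoding, so the
bit representation never affects the law. -/
theorem encoded_output {n m B w : ℕ} {S : Type} (enc : S → Memory n m B w)
    (dec : Memory n m B w → S) (h : Function.LeftInverse dec enc) (p : ℕ) (s₀ : S)
    (g : ℕ → S → Edge n m → S) (fin : ℕ → S → PMF S) (rep : S → Finset (Fin n))
    (σ : List (Edge n m)) :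
    (encoded enc dec p s₀ g fin rep).output σ = (passLaw s₀ g fin σ p).map rep := by
  set L : ℕ → PMF (Memory n m B w) := (encoded enc dec p s₀ g fin rep).afterPasses σ with hL
  have hsucc : ∀ j, L (j + 1) = (L j).bind fun s =>
      (consume (fun s e => PMF.pure (enc (g j (dec s) e))) σ s).bind
        fun s => (fin j (dec s)).map enc := fun _ => rfl
  have key : ∀ j, L j = (passLaw s₀ g fin σ j).map enc := by
    intro j
    induction j with
    | zero => exact (PMF.pure_map enc s₀).symm
    | succ j ih =>
      rw [hsucc, ih, passLaw, PMF.bind_map, PMF.map_bind]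
      congr 1
      funext s
      simp only [Function.comp_apply]
      rw [consume_pure_map enc dec h (g j) σ s, PMF.pure_bind, h]
  have hout : (encoded enc dec p s₀ g fin rep).output σ = (L p).map fun s => rep (dec s) := rfl
  rw [hout, key, PMF.map_comp]
  congr 1
  funext s
  exact congrArg rep (h s)

end Simulation

/-! ### Failure probabilities and uniform samples -/

section Probability

/-- Union bound for one step of a chain: either the current state is already bad, or the step fails
from a good one. Iterated, it adds up the failures of the rounds. -/
theorem toOuterMeasure_bind_compl_le {α β : Type} (p : PMF α) (f : α → PMF β) (G : Set α)
    (H : Set β) (a b : ENNReal) (ha : p.toOuterMeasure Gᶜ ≤ a)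
    (hb : ∀ s ∈ G, (f s).toOuterMeasure Hᶜ ≤ b) :
    (p.bind f).toOuterMeasure Hᶜ ≤ a + b := by
  rw [PMF.toOuterMeasure_bind_apply]
  calc ∑' s, p s * (f s).toOuterMeasure Hᶜ
      ≤ ∑' s, (Gᶜ.indicator p s + p s * b) := by
        refine ENNReal.tsum_le_tsum fun s => ?_
        by_cases hs : s ∈ G
        · exact (mul_le_mul_right (hb s hs) _).trans le_add_self
        · rw [Set.indicator_of_mem (show s ∈ Gᶜ from hs)]
          refine le_trans ?_ le_self_add
          have : (f s).toOuterMeasure Hᶜ ≤ 1 := by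
            rw [← ((f s).toOuterMeasure_apply_eq_one_iff Set.univ).2 (Set.subset_univ _)]
            exact MeasureTheory.measure_mono (Set.subset_univ _)
          exact mul_le_of_le_one_right' this
    _ ≤ a + b := by
        rw [ENNReal.tsum_add, ENNReal.tsum_mul_right, p.tsum_coe, one_mul,
          ← PMF.toOuterMeasure_apply]
        gcongr

theorem one_sub_le_toOuterMeasure {α : Type} (p : PMF α) (G : Set α) (a : ENNReal)
    (h : p.toOuterMeasure Gᶜ ≤ a) : 1 - a ≤ p.toOuterMeasure G := by
  rw [tsub_le_iff_right]
  calc (1 : ENNReal) = p.toOuterMeasure (G ∪ Gᶜ) := by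
        rw [Set.union_compl_self, (p.toOuterMeasure_apply_eq_one_iff _).2 (Set.subset_univ _)]
    _ ≤ p.toOuterMeasure G + p.toOuterMeasure Gᶜ := MeasureTheory.measure_union_le _ _
    _ ≤ _ := by gcongr

/-- `N` independent uniform samples from `U`; if `U` is empty, the fixed sequence `x₀`. -/
noncomputable def sampleLaw {m : ℕ} (N : ℕ) (U : Finset (Fin m)) (x₀ : Fin N → Fin m) :
    PMF (Fin N → Fin m) :=
  open Classical in
  if h : U.Nonempty then
    PMF.uniformOfFinset (Fintype.piFinset fun _ => U) (Fintype.piFinset_nonempty.2 fun _ => h)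
  else PMF.pure x₀

/-- The event is a product set, and each of the first `k` factors contributes `#(U ∩ G) / #U ≤ 1 - l
≤ exp (-l)`. -/
theorem sampleLaw_prefix_le {m N : ℕ} {U : Finset (Fin m)} (hU : U.Nonempty)
    (x₀ : Fin N → Fin m) (G : Finset (Fin m)) (l : ℝ) (hG : l * U.card ≤ (U \ G).card)
    (k : ℕ) (hk : k ≤ N) :
    (sampleLaw N U x₀).toOuterMeasure {x | ∀ t : Fin N, (t : ℕ) < k → x t ∈ G} ≤
      ENNReal.ofReal (Real.exp (-l) ^ k) := by
  classical
  rw [sampleLaw, dif_pos hU, PMF.toOuterMeasure_uniformOfFinset_apply]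
  have hu : (0 : ℝ) < U.card := by exact_mod_cast hU.card_pos
  have hsub : @Finset.filter _
        (fun x => x ∈ {x : Fin N → Fin m | ∀ t : Fin N, (t : ℕ) < k → x t ∈ G})
        (Classical.decPred _) (Fintype.piFinset fun _ : Fin N => U) =
      Fintype.piFinset fun t : Fin N => if (t : ℕ) < k then U ∩ G else U := by
    ext x
    simp only [Finset.mem_filter, Fintype.mem_piFinset, Set.mem_ofPred_eq]
    constructor
    · rintro ⟨h1, h2⟩ t
      split_ifs with ht
      · exact Finset.mem_inter.2 ⟨h1 t, h2 t ht⟩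
      · exact h1 t
    · intro h
      refine ⟨fun t => ?_, fun t ht => ?_⟩
      · have := h t
        split_ifs at this
        exacts [Finset.mem_of_mem_inter_left this, this]
      · have := h t
        rw [if_pos ht] at this
        exact Finset.mem_of_mem_inter_right this
  have hcard : (Finset.univ.filter fun t : Fin N => (t : ℕ) < k).card = k := by
    rw [Fin.card_filter_val_lt, min_eq_right hk]
  have hc : ((U ∩ G).card : ℝ) ≤ Real.exp (-l) * U.card := by
    have h1 : ((U ∩ G).card : ℝ) + (U \ G).card = U.card := by
      exact_mod_cast Finset.card_inter_add_card_sdiff U G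
    have h2 := Real.add_one_le_exp (-l)
    nlinarith
  rw [hsub, ← ENNReal.ofReal_natCast, ← ENNReal.ofReal_natCast, ← ENNReal.ofReal_div_of_pos]
  · apply ENNReal.ofReal_le_ofReal
    rw [Fintype.card_piFinset, Fintype.card_piFinset, Nat.cast_prod, Nat.cast_prod,
      ← Finset.prod_div_distrib]
    calc ∏ t : Fin N, (((if (t : ℕ) < k then U ∩ G else U).card : ℝ) / U.card)
        ≤ ∏ t : Fin N, (if (t : ℕ) < k then Real.exp (-l) else 1) := by
          refine Finset.prod_le_prod (fun t _ => by positivity) fun t _ => ?_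
          split_ifs
          · rwa [div_le_iff₀ hu]
          · rw [div_self hu.ne']
      _ = _ := by rw [Finset.prod_ite, Finset.prod_const, Finset.prod_const_one, mul_one, hcard]
  · rw [Fintype.card_piFinset]
    exact_mod_cast Finset.prod_pos fun _ _ => hU.card_pos

/-- The prefix length grows with `#T`, so a bad `T` has probability at most `y ^ #T` with `y = exp
(-l * q)`. The binomial theorem sums this over all `T`; the `-1` removes the empty family. -/
theorem sampleLaw_exists_le {n m q : ℕ} (U : Finset (Fin m)) (x₀ : Fin (n * q) → Fin m)
    (G : Finset (Fin n) → Finset (Fin m)) (l : ℝ) :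
    (sampleLaw (n * q) U x₀).toOuterMeasure
        {x | ∃ T : Finset (Fin n), T.Nonempty ∧ l * U.card < (U \ G T).card ∧
          ∀ t : Fin (n * q), (t : ℕ) < q * T.card → x t ∈ G T} ≤
      ENNReal.ofReal ((1 + Real.exp (-l * q)) ^ n - 1) := by
  classical
  set I : Finset (Finset (Fin n)) :=
    Finset.univ.filter fun T => T.Nonempty ∧ l * U.card < (U \ G T).card with hI
  have hsub : {x : Fin (n * q) → Fin m | ∃ T : Finset (Fin n), T.Nonempty ∧
        l * U.card < (U \ G T).card ∧ ∀ t : Fin (n * q), (t : ℕ) < q * T.card → x t ∈ G T} ⊆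
      ⋃ T ∈ I, {x | ∀ t : Fin (n * q), (t : ℕ) < q * T.card → x t ∈ G T} := by
    rintro x ⟨T, h1, h2, h3⟩
    simp only [Set.mem_iUnion]
    exact ⟨T, by simp [hI, h1, h2], h3⟩
  refine (MeasureTheory.measure_mono hsub).trans ?_
  refine (MeasureTheory.measure_biUnion_finset_le _ _).trans ?_
  set y := Real.exp (-l * q) with hy
  have hy0 : 0 ≤ y := (Real.exp_pos _).le
  calc _ ≤ ∑ T ∈ I, ENNReal.ofReal (y ^ T.card) := by
        refine Finset.sum_le_sum fun T hT => ?_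
        simp only [hI, Finset.mem_filter, Finset.mem_univ, true_and] at hT
        -- If `U` were empty, the strict inequality defining `I` would read `0 < 0`.
        have hU : U.Nonempty := by
          by_contra h
          rw [Finset.not_nonempty_iff_eq_empty] at h
          simp [h] at hT
        refine (sampleLaw_prefix_le hU x₀ (G T) l hT.2.le (q * T.card) ?_).trans ?_
        · rw [mul_comm]
          exact Nat.mul_le_mul_right _ ((Finset.card_le_univ T).trans (by simp))
        · apply le_of_eq
          rw [hy, mul_comm (-l) (q : ℝ), Real.exp_nat_mul, ← pow_mul]
    _ = ENNReal.ofReal (∑ T ∈ I, y ^ T.card) :=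
        (ENNReal.ofReal_sum_of_nonneg fun _ _ => by positivity).symm
    _ ≤ _ := by
        apply ENNReal.ofReal_le_ofReal
        have h1 : ∑ T ∈ (Finset.univ : Finset (Fin n)).powerset, y ^ T.card = (1 + y) ^ n := by
          have := Finset.sum_pow_mul_eq_add_pow y 1 (Finset.univ : Finset (Fin n))
          simpa [add_comm] using this
        have h2 : ∑ T ∈ I, y ^ T.card ≤
            ∑ T ∈ (Finset.univ : Finset (Fin n)).powerset.erase ∅, y ^ T.card := by
          refine Finset.sum_le_sum_of_subset_of_nonneg ?_ fun _ _ _ => by positivity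
          intro T hT
          simp only [hI, Finset.mem_filter, Finset.mem_univ, true_and] at hT
          simp [hT.1.ne_empty]
        have h3 := Finset.add_sum_erase (Finset.univ : Finset (Fin n)).powerset
          (fun T => y ^ T.card) (Finset.empty_mem_powerset _)
        simp only [Finset.card_empty, pow_zero] at h3
        linarith

end Probability

/-! ### Small hitting sets for large sets -/

section Hitting

/-- Greedy choice: by double counting, some index misses at most a fraction `1 - d / n ≤ exp (-(d /
n))` of the sets not yet hit. -/
theorem exists_hitting_set {ι : Type} {n : ℕ} (J : Finset ι) (A : ι → Finset (Fin n)) (d : ℝ)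
    (hn : 0 < n) (hd : ∀ t ∈ J, d ≤ (A t).card) (h : ℕ) :
    ∃ R : Finset (Fin n), R.card ≤ h ∧
      ((J.filter fun t => Disjoint (A t) R).card : ℝ) ≤ J.card * Real.exp (-(d / n)) ^ h := by
  classical
  induction h with
  | zero => exact ⟨∅, by simp, by simp⟩
  | succ h ih =>
    obtain ⟨R, hR, hcard⟩ := ih
    set J' := J.filter fun t => Disjoint (A t) R with hJ'
    have hexp := Real.add_one_le_exp (-(d / n))
    have hn' : (0 : ℝ) < n := by exact_mod_cast hn
    have hsum : ∑ i : Fin n, ((J'.filter fun t => i ∉ A t).card : ℝ) ≤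
        ∑ _i : Fin n, J'.card * Real.exp (-(d / n)) := by
      have h1 : ∑ i : Fin n, ((J'.filter fun t => i ∉ A t).card : ℝ) =
          ∑ t ∈ J', ((n : ℝ) - (A t).card) := by
        have h2 : ∀ t, ((n : ℝ) - (A t).card) = ((Finset.univ.filter fun i => i ∉ A t).card : ℝ) := by
          intro t
          have h3 := Finset.card_compl_add_card (A t)
          have h4 : (A t)ᶜ = Finset.univ.filter fun i => i ∉ A t := by ext; simp
          rw [h4, Fintype.card_fin] at h3
          have h5 : ((Finset.univ.filter fun i => i ∉ A t).card : ℝ) + (A t).card = n := by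
            exact_mod_cast h3
          linarith
        simp only [h2]
        exact_mod_cast Finset.sum_card_bipartiteAbove_eq_sum_card_bipartiteBelow
          (s := Finset.univ) (t := J') (fun i t => i ∉ A t)
      rw [h1]
      calc ∑ t ∈ J', ((n : ℝ) - (A t).card) ≤ ∑ _t ∈ J', ((n : ℝ) - d) :=
            Finset.sum_le_sum fun t ht => by
              have := hd t (Finset.mem_of_mem_filter t ht)
              linarith
        _ = J'.card * (n * (-(d / n) + 1)) := by
            rw [Finset.sum_const, nsmul_eq_mul]
            field_simp
            ring
        _ ≤ J'.card * (n * Real.exp (-(d / n))) := by gcongr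
        _ = _ := by
            rw [Finset.sum_const, nsmul_eq_mul, Finset.card_univ, Fintype.card_fin]
            ring
    have : Nonempty (Fin n) := ⟨⟨0, hn⟩⟩
    obtain ⟨i, -, hi⟩ := Finset.exists_le_of_sum_le Finset.univ_nonempty hsum
    refine ⟨insert i R, (Finset.card_insert_le _ _).trans (by omega), ?_⟩
    have hsub : (J.filter fun t => Disjoint (A t) (insert i R)) ⊆
        J'.filter fun t => i ∉ A t := by
      intro t ht
      simp only [hJ', Finset.mem_filter, Finset.disjoint_insert_right] at ht ⊢
      exact ⟨⟨ht.1, ht.2.2⟩, ht.2.1⟩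
    calc ((J.filter fun t => Disjoint (A t) (insert i R)).card : ℝ)
        ≤ (J'.filter fun t => i ∉ A t).card := by exact_mod_cast Finset.card_le_card hsub
      _ ≤ J'.card * Real.exp (-(d / n)) := hi
      _ ≤ (J.card * Real.exp (-(d / n)) ^ h) * Real.exp (-(d / n)) := by gcongr
      _ = _ := by ring

end Hitting

end EdgeArrival

/-! ### The element sampling algorithm on abstract states -/

namespace EdgeArrival

/-- A set of at most `c` indices of sets. -/
abbrev Bucket (n c : ℕ) : Type := {b : Finset (Fin n) // b.card ≤ c}

/-- The state of the element sampling algorithm: the marks, the sampled elements, for the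
`t`-th sampled element up to `cap t` sets that contain it, and the sets chosen so far. -/
structure SketchState (n m N : ℕ) (cap : ℕ → ℕ) : Type where
  marks : Fin m → Bool
  sample : Fin N → Fin m
  buckets : ∀ t : Fin N, Bucket n (cap t)
  chosen : Finset (Fin n)

namespace Bucket

variable {n c : ℕ}

/-- Insert an index if there is room. -/
def offer (b : Bucket n c) (i : Fin n) : Bucket n c :=
  if h : b.1.card < c then ⟨insert i b.1, (Finset.card_insert_le _ _).trans h⟩ else b

/-- Every index offered is either kept, or the bucket is full. -/
theorem foldl_offer {m : ℕ} (a : Fin m) (σ : List (Edge n m)) (b : Bucket n c) :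
    let b' := σ.foldl (fun b e => if a = e.2 then b.offer e.1 else b) b
    b.1 ⊆ b'.1 ∧ (∀ i ∈ b'.1, i ∈ b.1 ∨ (i, a) ∈ σ) ∧
      (b'.1.card < c → ∀ i, (i, a) ∈ σ → i ∈ b'.1) := by
  induction σ generalizing b with
  | nil => simp
  | cons e σ ih =>
    obtain ⟨e1, e2⟩ := e
    simp only [List.foldl_cons]
    by_cases ha : a = e2
    · subst ha
      simp only [if_true]
      obtain ⟨h1, h2, h3⟩ := ih (b.offer e1)
      have hsub : b.1 ⊆ (b.offer e1).1 := by
        unfold offer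
        split_ifs
        exacts [Finset.subset_insert _ _, subset_rfl]
      refine ⟨hsub.trans h1, fun i hi => ?_, fun hc i hi => ?_⟩
      · rcases h2 i hi with h | h
        · unfold offer at h
          split_ifs at h
          · rcases Finset.mem_insert.1 h with rfl | h
            · exact Or.inr List.mem_cons_self
            · exact Or.inl h
          · exact Or.inl h
        · exact Or.inr (List.mem_cons_of_mem _ h)
      · rcases List.mem_cons.1 hi with h | h
        · have h4 : i = e1 := congrArg Prod.fst h
          subst h4
          refine h1 ?_
          -- Buckets only grow, so one that is not full at the end had room when this edge arrived.
          have h5 := (Finset.card_le_card (hsub.trans h1)).trans_lt hc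
          rw [offer, dif_pos h5]
          exact Finset.mem_insert_self _ _
        · exact h3 hc i h
    · simp only [if_neg ha]
      obtain ⟨h1, h2, h3⟩ := ih b
      refine ⟨h1, fun i hi => (h2 i hi).imp_right (List.mem_cons_of_mem _), fun hc i hi => ?_⟩
      rcases List.mem_cons.1 hi with h | h
      · exact absurd (congrArg Prod.snd h) ha
      · exact h3 hc i h

end Bucket

namespace SketchState

variable {n m q : ℕ} {cap : ℕ → ℕ}

/-- Store an arriving edge in the buckets of its element. -/
def collect {N : ℕ} (s : SketchState n m N cap) (e : Edge n m) : SketchState n m N cap :=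
  { s with buckets := fun t => if s.sample t = e.2 then (s.buckets t).offer e.1 else s.buckets t }

/-- Mark the element of an arriving edge if its set is chosen. -/
def mark {N : ℕ} (s : SketchState n m N cap) (e : Edge n m) : SketchState n m N cap :=
  { s with marks := if e.1 ∈ s.chosen then Function.update s.marks e.2 true else s.marks }

/-- `T` hits each of the first `q * #T` buckets. -/
def Hits (q : ℕ) {N : ℕ} (s : SketchState n m N cap) (T : Finset (Fin n)) : Prop :=
  T.Nonempty ∧ ∀ t : Fin N, (t : ℕ) < q * T.card → ∃ i ∈ T, i ∈ (s.buckets t).1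

/-- A smallest family that hits the buckets, if there is one. -/
noncomputable def selection (q : ℕ) {N : ℕ} (s : SketchState n m N cap) : Finset (Fin n) :=
  Classical.epsilon fun T => s.Hits q T ∧ ∀ T', s.Hits q T' → T.card ≤ T'.card

theorem selection_spec {N : ℕ} {s : SketchState n m N cap} {T : Finset (Fin n)}
    (hT : s.Hits q T) :
    s.Hits q (s.selection q) ∧ (s.selection q).card ≤ T.card := by
  classical
  obtain ⟨T₀, h1, h2⟩ := Finset.exists_min_image (Finset.univ.filter fun T => s.Hits q T)
    Finset.card ⟨T, by simpa using hT⟩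
  have h := Classical.epsilon_spec (p := fun T => s.Hits q T ∧
    ∀ T', s.Hits q T' → T.card ≤ T'.card)
    ⟨T₀, by simpa using h1, fun T' hT' => h2 T' (by simpa using hT')⟩
  exact ⟨h.1, h.2 T hT⟩

/-- Choose the selected sets. -/
noncomputable def select (q : ℕ) {N : ℕ} (s : SketchState n m N cap) : SketchState n m N cap :=
  { s with chosen := s.chosen ∪ s.selection q }

/-- The unmarked elements. -/
def unmarked {N : ℕ} (s : SketchState n m N cap) : Finset (Fin m) :=
  Finset.univ.filter fun a => s.marks a = false

/-- Empty the buckets and install a new sequence of samples. -/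
def restart {N : ℕ} (s : SketchState n m N cap) (x : Fin N → Fin m) : SketchState n m N cap :=
  { s with sample := x, buckets := fun _ => ⟨∅, by simp⟩ }

/-- Draw new samples from the unmarked elements. -/
noncomputable def resample {N : ℕ} (s : SketchState n m N cap) : PMF (SketchState n m N cap) :=
  (sampleLaw N s.unmarked s.sample).map s.restart

theorem foldl_collect {N : ℕ} (σ : List (Edge n m)) (s : SketchState n m N cap) :
    σ.foldl collect s = ⟨s.marks, s.sample, fun t => σ.foldl
      (fun b e => if s.sample t = e.2 then b.offer e.1 else b) (s.buckets t), s.chosen⟩ := by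
  induction σ generalizing s with
  | nil => rfl
  | cons e σ ih => rw [List.foldl_cons, ih]; rfl

theorem foldl_mark {N : ℕ} (σ : List (Edge n m)) (s : SketchState n m N cap) :
    (σ.foldl mark s).chosen = s.chosen ∧ ∀ a, (σ.foldl mark s).marks a = true ↔
      s.marks a = true ∨ ∃ i ∈ s.chosen, (i, a) ∈ σ := by
  induction σ generalizing s with
  | nil => simp
  | cons e σ ih =>
    obtain ⟨e1, e2⟩ := e
    obtain ⟨h1, h2⟩ := ih (s.mark (e1, e2))
    rw [List.foldl_cons]
    refine ⟨h1, fun a => ?_⟩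
    rw [h2]
    simp only [mark, List.mem_cons, Prod.mk.injEq]
    by_cases he : e1 ∈ s.chosen
    · rw [if_pos he]
      by_cases ha : a = e2
      · subst ha
        simp only [Function.update_self, true_or, true_iff]
        exact Or.inr ⟨e1, he, by simp⟩
      · simp [ha]
    · rw [if_neg he]
      constructor
      · rintro (h | ⟨i, hi, h⟩)
        exacts [Or.inl h, Or.inr ⟨i, hi, Or.inr h⟩]
      · rintro (h | ⟨i, hi, ⟨rfl, -⟩ | h⟩)
        exacts [Or.inl h, absurd hi he, Or.inr ⟨i, hi, h⟩]

/-- The state update on an edge in pass `j`. -/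
def update {N : ℕ} (j : ℕ) (s : SketchState n m N cap) (e : Edge n m) : SketchState n m N cap :=
  if j % 3 = 1 then s.collect e else if j % 3 = 2 then s.mark e else s

/-- The state update at the end of pass `j`. -/
noncomputable def finish (q : ℕ) {N : ℕ} (j : ℕ) (s : SketchState n m N cap) :
    PMF (SketchState n m N cap) :=
  if j % 3 = 0 then s.resample else if j % 3 = 1 then PMF.pure (s.select q) else PMF.pure s

/-- Three passes over `σ` after the samples `x` have been drawn. -/
noncomputable def round (q : ℕ) {N : ℕ} (σ : List (Edge n m)) (s : SketchState n m N cap)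
    (x : Fin N → Fin m) : SketchState n m N cap :=
  σ.foldl mark ((σ.foldl collect (s.restart x)).select q)

/-- The first pass of a round ignores the edges; only its end is used, to draw the samples. The
other two passes are deterministic, so a round is a function of its samples. -/
theorem passLaw_three_mul {N : ℕ} (s₀ : SketchState n m N cap) (σ : List (Edge n m)) (j : ℕ) :
    passLaw s₀ update (finish q) σ (3 * (j + 1)) =
      (passLaw s₀ update (finish q) σ (3 * j)).bind fun s =>
        (sampleLaw N s.unmarked s.sample).map (s.round q σ) := by
  have h0 : (3 * j) % 3 = 0 := by omega
  have h1 : (3 * j + 1) % 3 = 1 := by omega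
  have h2 : (3 * j + 2) % 3 = 2 := by omega
  have hid : ∀ s : SketchState n m N cap, σ.foldl (fun s _ => s) s = s := by
    intro s
    induction σ with
    | nil => rfl
    | cons e σ ih => exact ih
  have e0 : (update (3 * j) : SketchState n m N cap → Edge n m → _) = fun s _ => s := by
    funext s e; simp [update, h0]
  have e1 : (update (3 * j + 1) : SketchState n m N cap → Edge n m → _) = collect := by
    funext s e; simp [update, h1]
  have e2 : (update (3 * j + 2) : SketchState n m N cap → Edge n m → _) = mark := by
    funext s e; simp [update, h2]
  have f0 : (finish q (3 * j) : SketchState n m N cap → _) = resample := by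
    funext s; simp [finish, h0]
  have f1 : (finish q (3 * j + 1) : SketchState n m N cap → _) =
      fun s => PMF.pure (s.select q) := by
    funext s; simp [finish, h1]
  have f2 : (finish q (3 * j + 2) : SketchState n m N cap → _) = PMF.pure := by
    funext s; simp [finish, h2]
  rw [show 3 * (j + 1) = 3 * j + 2 + 1 by ring, passLaw, passLaw, passLaw, e0, e1, e2, f0, f1, f2,
    PMF.bind_bind, PMF.bind_bind]
  congr 1
  funext s
  rw [hid, resample, PMF.bind_map]
  simp only [PMF.pure_bind]
  rfl

end SketchState

/-! ### Analysis of one round and of their succession -/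

section Round

variable {n m q K : ℕ}

/-- The number of sets kept for the `t`-th sample. -/
def bucketCap (n q K t : ℕ) : ℕ := K * n * q / (t + 1) + 1

/-- The `+ 1` in the capacity absorbs the rounding down, and `t + 1 ≤ 2 * k * q`. -/
theorem le_bucketCap {t c k : ℕ} (ht : t < q * c) (hc : c ≤ 2 * k) :
    (K : ℝ) * n / (2 * k) ≤ bucketCap n q K t := by
  have hq : 0 < q := Nat.pos_of_ne_zero fun h => by simp [h] at ht
  have hc0 : 0 < c := Nat.pos_of_ne_zero fun h => by simp [h] at ht
  have hk : 0 < k := by omega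
  have h1 : ((K * n * q : ℕ) : ℝ) / ((t + 1 : ℕ) : ℝ) ≤ bucketCap n q K t := by
    have := (Nat.lt_floor_add_one (((K * n * q : ℕ) : ℝ) / ((t + 1 : ℕ) : ℝ))).le
    rw [Nat.floor_div_eq_div] at this
    rw [bucketCap]
    exact_mod_cast this
  refine le_trans ?_ h1
  have h2 : ((t + 1 : ℕ) : ℝ) ≤ q * (2 * k) := by
    have : t + 1 ≤ q * (2 * k) := (Nat.succ_le_of_lt ht).trans (Nat.mul_le_mul_left _ hc)
    exact_mod_cast this
  have hq' : (0 : ℝ) < q := by exact_mod_cast hq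
  have hk' : (0 : ℝ) < k := by exact_mod_cast hk
  rw [div_le_div_iff₀ (by positivity) (by positivity)]
  push_cast at h2 ⊢
  calc (K : ℝ) * n * (t + 1) ≤ K * n * (q * (2 * k)) := by gcongr
    _ = _ := by ring

/-- From an optimal cover and a hitting set of the full buckets, one gets a small family that
hits all the buckets it has to hit. -/
theorem exists_hits {F : Fin n → Finset (Fin m)} {ε : ℝ} (hε : 0 < ε) (hε1 : ε ≤ 1) (hn : 0 < n)
    (hm : 0 < m) {l : ℝ} (hl : 1 ≤ l) (hK : 16 * l / ε ≤ K)
    (hN : ((n * q : ℕ) : ℝ) * Real.exp (-(4 * l)) < 1)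
    (s : SketchState n m (n * q) (bucketCap n q K))
    (hs : ∀ t, (s.buckets t).1.card < bucketCap n q K t → ∀ i, s.sample t ∈ F i →
      i ∈ (s.buckets t).1)
    (O : Finset (Fin n)) (hO : IsSetCover F O) :
    ∃ T, s.Hits q T ∧ (T.card : ℝ) ≤ (1 + ε) * O.card := by
  classical
  have hn' : (0 : ℝ) < n := by exact_mod_cast hn
  have hOne : O.Nonempty := by
    obtain ⟨i, hi, -⟩ := hO ⟨0, hm⟩
    exact ⟨i, hi⟩
  set k := O.card with hk
  have hk0 : (0 : ℝ) < k := by exact_mod_cast hOne.card_pos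
  -- The number of extra sets that the approximation factor allows.
  set h := ⌊ε * k⌋₊ with hh
  have hh1 : (h : ℝ) ≤ ε * k := Nat.floor_le (by positivity)
  have hh2 : ε * k < h + 1 := Nat.lt_floor_add_one _
  have hhk : h ≤ k := by
    have : (h : ℝ) ≤ k := hh1.trans (mul_le_of_le_one_left hk0.le hε1)
    exact_mod_cast this
  set d : ℝ := (K : ℝ) * n / (2 * k) with hd
  set J : Finset (Fin (n * q)) := Finset.univ.filter fun t => d ≤ (s.buckets t).1.card with hJ
  obtain ⟨R, hR, hRc⟩ := exists_hitting_set J (fun t => (s.buckets t).1) d hn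
    (fun t ht => (Finset.mem_filter.1 ht).2) h
  have hdl : 8 * l * n / (ε * k) ≤ d := by
    rw [hd, div_le_div_iff₀ (by positivity) (by positivity)]
    rw [div_le_iff₀ hε] at hK
    calc 8 * l * n * (2 * k) = 16 * l * (n * k) := by ring
      _ ≤ K * ε * (n * k) := by gcongr
      _ = _ := by ring
  have hhit : ∀ t, d ≤ (s.buckets t).1.card → ∃ i ∈ R, i ∈ (s.buckets t).1 := by
    intro t ht
    -- If `ε * k < 1`, no extra set is allowed, but then `d > n` and no bucket is that large.
    by_cases h0 : h = 0
    · exfalso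
      rw [h0, Nat.cast_zero, zero_add] at hh2
      have h1 : ((s.buckets t).1.card : ℝ) ≤ n := by
        exact_mod_cast (Finset.card_le_univ (s.buckets t).1).trans (by simp)
      have h2 : (n : ℝ) < 8 * l * n / (ε * k) := by
        rw [lt_div_iff₀ (by positivity)]
        nlinarith
      linarith
    · have h1 : (1 : ℝ) ≤ h := by exact_mod_cast Nat.one_le_iff_ne_zero.2 h0
      have h2 : Real.exp (-(d / n)) ^ h ≤ Real.exp (-(4 * l)) := by
        rw [← Real.exp_nat_mul, Real.exp_le_exp]
        have h3 : 8 * l / (ε * k) ≤ d / n := by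
          rw [le_div_iff₀ hn']
          calc _ = 8 * l * n / (ε * k) := by ring
            _ ≤ d := hdl
        -- Here `ε * k < h + 1 ≤ 2 * h`, so `h` is at least half of `ε * k`.
        have h4 : 4 * l ≤ h * (8 * l / (ε * k)) := by
          rw [← mul_div_assoc, le_div_iff₀ (by positivity)]
          nlinarith
        have h5 : (h : ℝ) * (8 * l / (ε * k)) ≤ h * (d / n) := by gcongr
        linarith
      have h3 : (J.card : ℝ) ≤ ((n * q : ℕ) : ℝ) := by
        exact_mod_cast (Finset.card_le_univ J).trans (by simp)
      have h4 : ((J.filter fun t => Disjoint (s.buckets t).1 R).card : ℝ) < 1 := by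
        refine lt_of_le_of_lt (hRc.trans ?_) hN
        gcongr
      have h5 : (J.filter fun t => Disjoint (s.buckets t).1 R) = ∅ := by
        rw [← Finset.card_eq_zero]
        have : (J.filter fun t => Disjoint (s.buckets t).1 R).card < 1 := by exact_mod_cast h4
        omega
      by_contra hcon
      push Not at hcon
      have h6 : t ∈ J.filter fun t => Disjoint (s.buckets t).1 R := by
        rw [Finset.mem_filter]
        exact ⟨Finset.mem_filter.2 ⟨Finset.mem_univ _, ht⟩,
          Finset.disjoint_left.2 fun i hi hiR => hcon i hiR hi⟩
      rw [h5] at h6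
      simp at h6
  have hcard : (O ∪ R).card ≤ k + h := (Finset.card_union_le _ _).trans (by omega)
  -- The cover `O` hits the buckets that are not full, since they hold every set containing their
  -- sample; `R` hits the full ones.
  refine ⟨O ∪ R, ⟨hOne.mono Finset.subset_union_left, fun t ht => ?_⟩, ?_⟩
  · by_cases hfull : (s.buckets t).1.card < bucketCap n q K t
    · obtain ⟨i, hi, hmem⟩ := hO (s.sample t)
      exact ⟨i, Finset.mem_union_left _ hi, hs t hfull i hmem⟩
    · have h1 := le_bucketCap (n := n) (K := K) ht (hcard.trans (by omega) : _ ≤ 2 * k)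
      have h2 : (bucketCap n q K t : ℝ) ≤ (s.buckets t).1.card := by
        exact_mod_cast not_lt.1 hfull
      obtain ⟨i, hi, hmem⟩ := hhit t (h1.trans h2)
      exact ⟨i, Finset.mem_union_right _ hi, hmem⟩
  · have : ((O ∪ R).card : ℝ) ≤ k + h := by exact_mod_cast hcard
    linarith

/-- After `j` rounds the marks are right, the chosen family is small, and few elements are
unmarked. -/
structure Progress (F : Fin n → Finset (Fin m)) (ε l : ℝ) (j : ℕ) {N : ℕ} {cap : ℕ → ℕ}
    (s : SketchState n m N cap) : Prop where
  marks : ∀ a, s.marks a = true ↔ ∃ i ∈ s.chosen, a ∈ F i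
  card : ∀ O, IsSetCover F O → (s.chosen.card : ℝ) ≤ j * ((1 + ε) * O.card)
  unmarked : (s.unmarked.card : ℝ) ≤ l ^ j * m

/-- Buckets contain only sets through their sample, so a selection hitting its buckets covers its
prefix of samples. Hypothesis `hx` excludes that such a family leaves more than a fraction `lam`
uncovered. -/
theorem round_progress {F : Fin n → Finset (Fin m)} {ε : ℝ} (hε : 0 < ε) (hε1 : ε ≤ 1)
    (hn : 0 < n) (hm : 0 < m) (hF : ∀ e, ∃ i, e ∈ F i) {l : ℝ} (hl : 1 ≤ l)
    (hK : 16 * l / ε ≤ K) (hN : ((n * q : ℕ) : ℝ) * Real.exp (-(4 * l)) < 1)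
    {σ : List (Edge n m)} (hσ : IsEdgeStream F σ) {lam : ℝ} (hlam : 0 ≤ lam) {j : ℕ}
    {s : SketchState n m (n * q) (bucketCap n q K)} (hs : Progress F ε lam j s)
    {x : Fin (n * q) → Fin m}
    (hx : ¬ ∃ T : Finset (Fin n), T.Nonempty ∧
      lam * s.unmarked.card < (s.unmarked \ T.biUnion F).card ∧
        ∀ t : Fin (n * q), (t : ℕ) < q * T.card → x t ∈ T.biUnion F) :
    Progress F ε lam (j + 1) (s.round q σ x) := by
  classical
  set s₁ := σ.foldl SketchState.collect (s.restart x) with hs₁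
  have hs₁' := SketchState.foldl_collect σ (s.restart x)
  rw [← hs₁] at hs₁'
  have hchosen : s₁.chosen = s.chosen := by rw [hs₁']; rfl
  have hmarks : s₁.marks = s.marks := by rw [hs₁']; rfl
  have hsample : s₁.sample = x := by rw [hs₁']; rfl
  have hb : ∀ t, (∀ i ∈ (s₁.buckets t).1, x t ∈ F i) ∧
      ((s₁.buckets t).1.card < bucketCap n q K t → ∀ i, x t ∈ F i → i ∈ (s₁.buckets t).1) := by
    intro t
    obtain ⟨-, h2, h3⟩ := Bucket.foldl_offer (x t) σ
      (⟨∅, by simp⟩ : Bucket n (bucketCap n q K t))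
    rw [hs₁']
    refine ⟨fun i hi => ?_, fun hc i hi => h3 hc i ((hσ.2 i (x t)).2 hi)⟩
    rcases h2 i hi with h | h
    · simp at h
    · exact (hσ.2 i (x t)).1 h
  have hhits := exists_hits hε hε1 hn hm hl hK hN s₁ (by rw [hsample]; exact fun t => (hb t).2)
  set T := s₁.selection q with hT
  have hTspec : s₁.Hits q T := by
    -- Any cover shows that some family hits its buckets; the family of all sets will do.
    obtain ⟨T', hT', -⟩ := hhits Finset.univ fun e => by simpa using hF e
    exact (SketchState.selection_spec hT').1
  have hround : s.round q σ x = σ.foldl SketchState.mark (s₁.select q) := rfl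
  obtain ⟨hc, hmk⟩ := SketchState.foldl_mark σ (s₁.select q)
  rw [← hround] at hc hmk
  have hch : (s₁.select q).chosen = s.chosen ∪ T := by
    rw [← hchosen]; rfl
  rw [hch] at hc hmk
  have hmk' : ∀ a, (s.round q σ x).marks a = true ↔ ∃ i ∈ s.chosen ∪ T, a ∈ F i := by
    intro a
    have h1 : (s₁.select q).marks a = s.marks a := congrFun hmarks a
    rw [hmk, h1, hs.marks]
    simp only [hσ.2]
    constructor
    · rintro (⟨i, hi, h⟩ | h)
      exacts [⟨i, Finset.mem_union_left _ hi, h⟩, h]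
    · exact Or.inr
  refine ⟨by rw [hc]; exact hmk', fun O hO => ?_, ?_⟩
  · obtain ⟨T', hT', hT'c⟩ := hhits O hO
    have h1 : (T.card : ℝ) ≤ T'.card := by
      exact_mod_cast (SketchState.selection_spec hT').2
    have h2 : ((s.chosen ∪ T).card : ℝ) ≤ s.chosen.card + T.card := by
      exact_mod_cast Finset.card_union_le _ _
    have h3 := hs.card O hO
    rw [hc]
    push_cast
    linarith
  · have h1 : (s.round q σ x).unmarked = s.unmarked \ T.biUnion F := by
      ext a
      have h2 := hmk' a
      have h3 := hs.marks a
      simp only [SketchState.unmarked, Finset.mem_filter, Finset.mem_univ, true_and,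
        Finset.mem_sdiff, Finset.mem_biUnion, ← Bool.not_eq_true, h2, h3, Finset.mem_union]
      constructor
      · intro h
        exact ⟨fun ⟨i, hi, ha⟩ => h ⟨i, Or.inl hi, ha⟩, fun ⟨i, hi, ha⟩ => h ⟨i, Or.inr hi, ha⟩⟩
      · rintro ⟨h, h'⟩ ⟨i, hi | hi, ha⟩
        exacts [h ⟨i, hi, ha⟩, h' ⟨i, hi, ha⟩]
    have h2 : ((s.unmarked \ T.biUnion F).card : ℝ) ≤ lam * s.unmarked.card := by
      by_contra hcon
      refine hx ⟨T, hTspec.1, not_le.1 hcon, fun t ht => ?_⟩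
      obtain ⟨i, hi, hit⟩ := hTspec.2 t ht
      exact Finset.mem_biUnion.2 ⟨i, hi, (hb t).1 i hit⟩
    rw [h1]
    calc _ ≤ lam * s.unmarked.card := h2
      _ ≤ lam * (lam ^ j * m) := by gcongr; exact hs.unmarked
      _ = _ := by ring

/-- The state after `r` rounds makes progress, up to a failure probability that adds up over
the rounds. -/
theorem passLaw_progress {F : Fin n → Finset (Fin m)} {ε : ℝ} (hε : 0 < ε) (hε1 : ε ≤ 1)
    (hn : 0 < n) (hm : 0 < m) (hF : ∀ e, ∃ i, e ∈ F i) {l : ℝ} (hl : 1 ≤ l)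
    (hK : 16 * l / ε ≤ K) (hN : ((n * q : ℕ) : ℝ) * Real.exp (-(4 * l)) < 1)
    {σ : List (Edge n m)} (hσ : IsEdgeStream F σ) {lam : ℝ} (hlam : 0 ≤ lam)
    {s₀ : SketchState n m (n * q) (bucketCap n q K)} (h₀ : Progress F ε lam 0 s₀) (r : ℕ) :
    (passLaw s₀ SketchState.update (SketchState.finish q) σ (3 * r)).toOuterMeasure
        {s | Progress F ε lam r s}ᶜ ≤
      r * ENNReal.ofReal ((1 + Real.exp (-lam * q)) ^ n - 1) := by
  induction r with
  | zero =>
    rw [mul_zero, passLaw, PMF.toOuterMeasure_pure_apply, if_neg]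
    · simp
    · exact fun h => h h₀
  | succ r ih =>
    rw [SketchState.passLaw_three_mul, Nat.cast_succ, add_mul, one_mul]
    refine toOuterMeasure_bind_compl_le _ _ _ _ _ _ ih fun s hs => ?_
    rw [PMF.toOuterMeasure_map_apply]
    refine le_trans (MeasureTheory.measure_mono fun x hx => ?_)
      (sampleLaw_exists_le s.unmarked s.sample (fun T => T.biUnion F) lam)
    by_contra hcon
    exact hx (round_progress hε hε1 hn hm hF hl hK hN hσ hlam hs hcon)

end Round

end EdgeArrival

namespace EdgeArrival

/-! ### Counting bits -/

section Space

/-- A bucket, listed and padded with `none`, is a word of length `c` over `n + 1` letters. -/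
theorem card_bucket_le (n c : ℕ) : Fintype.card (Bucket n c) ≤ (n + 1) ^ c := by
  let f : Bucket n c → Fin c → Option (Fin n) := fun b i => b.1.toList[(i : ℕ)]?
  have hf : Function.Injective f := by
    intro b b' h
    have h1 : b.1.toList = b'.1.toList := by
      apply List.ext_getElem?
      intro i
      by_cases hi : i < c
      · exact congrFun h ⟨i, hi⟩
      · rw [List.getElem?_eq_none, List.getElem?_eq_none]
        · rw [Finset.length_toList]; exact b'.2.trans (not_lt.1 hi)
        · rw [Finset.length_toList]; exact b.2.trans (not_lt.1 hi)
    exact Subtype.ext (by rw [← Finset.toList_toFinset b.1, h1, Finset.toList_toFinset])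
  have := Fintype.card_le_of_injective f hf
  simpa using this

/-- A sketch state fits into the marks and `N * L + (∑ t, cap t) * L + n` bits. -/
theorem exists_encoding {n m N L : ℕ} {cap : ℕ → ℕ} (hm : m ≤ 2 ^ L) (hn : n + 1 ≤ 2 ^ L) :
    ∃ enc : SketchState n m N cap →
      Memory n m 0 (N * L + (∑ t ∈ Finset.range N, cap t) * L + n), Function.Injective enc := by
  have hcard : Fintype.card
      ((Fin N → Fin m) × (∀ t : Fin N, Bucket n (cap t)) × Finset (Fin n)) ≤
      Fintype.card (Fin (N * L + (∑ t ∈ Finset.range N, cap t) * L + n) → Bool) := by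
    simp only [Fintype.card_prod, Fintype.card_fun, Fintype.card_pi, Fintype.card_fin,
      Fintype.card_finset, Fintype.card_bool]
    rw [pow_add, pow_add, mul_assoc]
    refine Nat.mul_le_mul ?_ (Nat.mul_le_mul_right _ ?_)
    · rw [mul_comm N L, pow_mul]
      exact Nat.pow_le_pow_left hm _
    · rw [← Fin.sum_univ_eq_sum_range, Finset.sum_mul, ← Finset.prod_pow_eq_pow_sum]
      refine Finset.prod_le_prod' fun t _ => (card_bucket_le _ _).trans ?_
      rw [mul_comm, pow_mul]
      exact Nat.pow_le_pow_left hn _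
  obtain ⟨f⟩ := Function.Embedding.nonempty_of_card_le hcard
  -- No edge cells are used: all but the marks goes into the work bits.
  refine ⟨fun s => ⟨Fin.elim0, s.marks, f (s.sample, s.buckets, s.chosen)⟩, fun s s' h => ?_⟩
  have h1 : s.marks = s'.marks := congrArg Memory.marks h
  have h2 := f.injective (congrArg Memory.work h)
  obtain ⟨a, b, c, d⟩ := s
  obtain ⟨a', b', c', d'⟩ := s'
  simp only [Prod.mk.injEq] at h1 h2
  obtain ⟨rfl, rfl, rfl⟩ := h2
  subst h1
  rfl

theorem sum_bucketCap_le (n q K N : ℕ) :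
    ((∑ t ∈ Finset.range N, bucketCap n q K t : ℕ) : ℝ) ≤
      K * (n * q) * (1 + Real.log N) + N := by
  have h1 : ∀ t, ((bucketCap n q K t : ℕ) : ℝ) ≤ K * (n * q) * ((t : ℝ) + 1)⁻¹ + 1 := by
    intro t
    rw [bucketCap, Nat.cast_add, Nat.cast_one]
    gcongr
    refine Nat.cast_div_le.trans (le_of_eq ?_)
    push_cast
    ring
  have h2 : ∑ t ∈ Finset.range N, ((t : ℝ) + 1)⁻¹ ≤ 1 + Real.log N := by
    have := harmonic_le_one_add_log N
    rw [harmonic] at this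
    push_cast at this
    exact this
  rw [Nat.cast_sum]
  calc _ ≤ ∑ t ∈ Finset.range N, ((K : ℝ) * (n * q) * ((t : ℝ) + 1)⁻¹ + 1) :=
        Finset.sum_le_sum fun t _ => h1 t
    _ = K * (n * q) * ∑ t ∈ Finset.range N, ((t : ℝ) + 1)⁻¹ + N := by
        rw [Finset.sum_add_distrib, Finset.mul_sum]; simp
    _ ≤ _ := by gcongr

theorem natCeil_le_add_mul {c x y : ℝ} (hc : 0 ≤ c) (h : 1 ≤ x) (hy : y = c * x) :
    (⌈y⌉₊ : ℝ) ≤ (c + 1) * x := by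
  have := (Nat.ceil_lt_add_one (show 0 ≤ y by rw [hy]; positivity)).le
  linarith

end Space

/-! ### Numerical estimates for the parameters -/

section Parameters

variable {n m r : ℕ}

/-- The four factors `l` come from `q`, from `K`, from the harmonic sum and from the bits per index.
-/
theorem workBits_le {ε l X : ℝ} (hε : 0 < ε) (hε1 : ε ≤ 1) (hl : 1 ≤ l) (hX : 1 ≤ X)
    (hn : 0 < n) {q K L : ℕ} (hq : (q : ℝ) ≤ 9 * (X * l)) (hq0 : 0 < q)
    (hK : (K : ℝ) ≤ 17 * (l / ε)) (hL : (L : ℝ) ≤ 3 * l) (hlog : Real.log (n * q : ℕ) ≤ 5 * l) :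
    ((n * q * L + (∑ t ∈ Finset.range (n * q), bucketCap n q K t) * L + n : ℕ) : ℝ) ≤
      3000 / ε * (n * X) * l ^ 4 := by
  have hn' : (1 : ℝ) ≤ n := by exact_mod_cast hn
  have hsum := sum_bucketCap_le n q K (n * q)
  set B := ∑ t ∈ Finset.range (n * q), bucketCap n q K t
  have h1 : (1 : ℝ) ≤ l / ε := by rw [le_div_iff₀ hε]; linarith
  have h3 : (1 : ℝ) ≤ l / ε * l := one_le_mul_of_one_le_of_one_le h1 hl
  have hq1 : (1 : ℝ) ≤ q := by exact_mod_cast hq0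
  have h2 : (B : ℝ) ≤ 103 * (n * q) * (l / ε * l) := by
    push_cast at hsum hlog
    have h4 : (K : ℝ) * (n * q) * (1 + Real.log (n * q)) ≤ 17 * (l / ε) * (n * q) * (6 * l) :=
      calc _ ≤ (K : ℝ) * (n * q) * (6 * l) := by gcongr; linarith
        _ ≤ _ := by gcongr
    have h5 : (n : ℝ) * q ≤ n * q * (l / ε * l) := le_mul_of_one_le_right (by positivity) h3
    linarith
  push_cast
  have h6 : (n : ℝ) * q * L ≤ n * q * (3 * l) * (l / ε * l) :=
    calc (n : ℝ) * q * L ≤ n * q * (3 * l) := by gcongr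
      _ ≤ _ := le_mul_of_one_le_right (by positivity) h3
  have h7 : (B : ℝ) * L ≤ 103 * (n * q) * (l / ε * l) * (3 * l) := by gcongr
  have h8 : (n : ℝ) ≤ n * (q * l * (l / ε * l)) := le_mul_of_one_le_right (by positivity)
    (one_le_mul_of_one_le_of_one_le (one_le_mul_of_one_le_of_one_le hq1 hl) h3)
  calc (n : ℝ) * q * L + B * L + n
      ≤ n * q * (3 * l) * (l / ε * l) + 103 * (n * q) * (l / ε * l) * (3 * l) +
        n * (q * l * (l / ε * l)) := add_le_add (add_le_add h6 h7) h8
    _ = 313 * (l / ε * l * l) * n * q := by ring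
    _ ≤ 313 * (l / ε * l * l) * n * (9 * (X * l)) := by gcongr
    _ = 2817 / ε * (n * X) * l ^ 4 := by ring
    _ ≤ 3000 / ε * (n * X) * l ^ 4 := by gcongr; norm_num

/-- As `n * y ≤ 1`, `(1 + y) ^ n - 1 ≤ exp (n * y) - 1 ≤ 2 * n * y`; the bounds `r ≤ m` and `2 ≤ m`
then leave `y * Z ^ 2`. -/
theorem failure_le {Z y : ℝ} (hn : 0 < n) (hr : r ≤ m) (hm : 2 ≤ m) (hZ : Z = n * m)
    (hy0 : 0 ≤ y) (hy : y * Z ^ 4 ≤ 1) :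
    (r : ENNReal) * ENNReal.ofReal ((1 + y) ^ n - 1) ≤ (n : ENNReal)⁻¹ := by
  have hn' : (1 : ℝ) ≤ n := by exact_mod_cast hn
  have hm' : (2 : ℝ) ≤ m := by exact_mod_cast hm
  have hr' : (r : ℝ) ≤ m := by exact_mod_cast hr
  have hZ1 : 1 ≤ Z := by rw [hZ]; nlinarith
  have hnZ : (n : ℝ) ≤ Z := by rw [hZ]; nlinarith
  have hny : n * y ≤ 1 := by
    calc n * y ≤ Z ^ 4 * y := by
          gcongr
          exact hnZ.trans (le_self_pow₀ hZ1 (by norm_num))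
      _ ≤ 1 := by linarith
  have h1 : (1 + y) ^ n - 1 ≤ 2 * (n * y) := by
    have h2 : (1 + y) ^ n ≤ Real.exp (n * y) := by
      rw [Real.exp_nat_mul]
      gcongr
      linarith [Real.add_one_le_exp y]
    have hny0 : 0 ≤ n * y := by positivity
    have h3 := Real.abs_exp_sub_one_le (x := n * y) (by rwa [abs_of_nonneg hny0])
    rw [abs_of_nonneg hny0] at h3
    linarith [le_abs_self (Real.exp (n * y) - 1)]
  rw [← ENNReal.ofReal_natCast r, ← ENNReal.ofReal_natCast n,
    ← ENNReal.ofReal_inv_of_pos (by linarith), ← ENNReal.ofReal_mul (by positivity)]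
  apply ENNReal.ofReal_le_ofReal
  rw [← one_div, le_div_iff₀ (by linarith)]
  calc (r : ℝ) * ((1 + y) ^ n - 1) * n ≤ m * (m * (n * y)) * n := by
        have h2 : (1 + y) ^ n - 1 ≤ m * (n * y) := h1.trans (by gcongr)
        have h3 : 0 ≤ (1 + y) ^ n - 1 := sub_nonneg.2 (one_le_pow₀ (by linarith))
        gcongr
    _ = y * Z ^ 2 := by rw [hZ]; ring
    _ ≤ y * Z ^ 4 := by gcongr; norm_num
    _ ≤ 1 := hy

end Parameters

/-! ### Choice of parameters and conclusion -/

/-- The algorithm that does nothing. -/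
noncomputable def trivialAlgorithm (n m : ℕ) : StreamingAlgorithm n m where
  passes := 0
  edgeCells := 0
  workBits := 0
  init := PMF.pure ⟨Fin.elim0, fun _ => false, Fin.elim0⟩
  step _ s _ := PMF.pure s
  endPass _ s := PMF.pure s
  report _ := ∅

/-- Set cover by repeated element sampling, with space `n * m ^ (1 / r)` up to logarithms. -/
theorem exists_setCover_algorithm {ε : ℝ} (hε : 0 < ε) (hε1 : ε ≤ 1) {n m r : ℕ} (hn : 0 < n)
    (hr : 1 ≤ r) (hrm : (r : ℝ) ≤ Real.log m) :
    ∃ A : StreamingAlgorithm n m, A.passes ≤ 3 * r ∧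
      (A.space : ℝ) ≤ 3000 / ε * (n * (m : ℝ) ^ ((1 : ℝ) / r)) * Real.log (n * m) ^ 4 ∧
      ∀ F : Fin n → Finset (Fin m), (∀ e : Fin m, ∃ i : Fin n, e ∈ F i) →
        ∀ σ : List (Edge n m), IsEdgeStream F σ →
          1 - (n : ENNReal)⁻¹ ≤ (A.output σ).toOuterMeasure
            {S : Finset (Fin n) | IsApproxSetCover ((1 + ε) * Real.log m) F S} := by
  have hr' : (1 : ℝ) ≤ r := by exact_mod_cast hr
  have hn' : (1 : ℝ) ≤ n := by exact_mod_cast hn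
  have hm0 : 0 < m := Nat.pos_of_ne_zero fun h => by
    rw [h, Nat.cast_zero, Real.log_zero] at hrm
    linarith
  have hm0' : (0 : ℝ) < m := by exact_mod_cast hm0
  have hrm' : (r : ℝ) ≤ m - 1 := hrm.trans (Real.log_le_sub_one_of_pos hm0')
  have hm3 : 3 ≤ m := by
    have h1 : Real.exp 1 ≤ m := by
      rw [← Real.le_log_iff_exp_le hm0']
      linarith
    have h2 : (2 : ℝ) < m := lt_of_lt_of_le (by linarith [Real.exp_one_gt_d9]) h1
    exact_mod_cast h2
  have hm3' : (3 : ℝ) ≤ m := by exact_mod_cast hm3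
  set Z : ℝ := n * m with hZ
  set l := Real.log Z with hl
  set X := (m : ℝ) ^ ((1 : ℝ) / r) with hX
  have hZm : (m : ℝ) ≤ Z := le_mul_of_one_le_left (by linarith) hn'
  have hZ3 : 3 ≤ Z := hm3'.trans hZm
  have hl1 : 1 ≤ l := (hr'.trans hrm).trans (Real.log_le_log hm0' hZm)
  have hlZ : l < Z := by
    have := Real.log_le_sub_one_of_pos (show 0 < Z by linarith)
    linarith
  have hexp : Real.exp l = Z := Real.exp_log (by linarith)
  have hexp4 : Real.exp (-(4 * l)) * Z ^ 4 = 1 := by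
    rw [← hexp, ← Real.exp_nat_mul, ← Real.exp_add]
    norm_num
  have hX1 : 1 ≤ X := Real.one_le_rpow (by linarith) (by positivity)
  have hXr : X ^ r = m := by
    rw [hX, ← Real.rpow_natCast, ← Real.rpow_mul hm0'.le, one_div,
      inv_mul_cancel₀ (by positivity), Real.rpow_one]
  have hXm : X ≤ m := hXr ▸ le_self_pow₀ hX1 (by omega)
  have hXl : 1 ≤ X * l := one_le_mul_of_one_le_of_one_le hX1 hl1
  -- With `lam = 1 / (2 * X)` this gives `lam * q ≥ 4 * l`, hence `exp (-lam * q) ≤ Z ^ (-4)`. The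
  -- value of `K` is what `exists_hits` needs, and `L` suffices because `2 * log 2 > 1`.
  set q := ⌈8 * (X * l)⌉₊ with hq
  set K := ⌈16 * (l / ε)⌉₊ with hK
  set L := ⌈2 * l⌉₊ with hL
  have hq9 : (q : ℝ) ≤ 9 * (X * l) :=
    (natCeil_le_add_mul (by norm_num) hXl rfl).trans_eq (by norm_num)
  have hq8 : 8 * (X * l) ≤ q := Nat.le_ceil _
  have hq0 : 0 < q := Nat.ceil_pos.2 (by linarith)
  have hlε : 1 ≤ l / ε := by rw [le_div_iff₀ hε]; linarith
  have hK17 : (K : ℝ) ≤ 17 * (l / ε) :=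
    (natCeil_le_add_mul (by norm_num) hlε rfl).trans_eq (by norm_num)
  have hK16 : 16 * l / ε ≤ K := by rw [mul_div_assoc]; exact Nat.le_ceil _
  have hL3 : (L : ℝ) ≤ 3 * l :=
    (natCeil_le_add_mul (by norm_num) hl1 rfl).trans_eq (by norm_num)
  have hZL : Z ≤ 2 ^ L := by
    rw [← hexp, ← Real.rpow_natCast, Real.rpow_def_of_pos (by norm_num), Real.exp_le_exp]
    have h1 : 2 * l ≤ L := Nat.le_ceil _
    have h2 := Real.log_two_gt_d9
    nlinarith
  have hmL : m ≤ 2 ^ L := by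
    have : (m : ℝ) ≤ 2 ^ L := hZm.trans hZL
    exact_mod_cast this
  have hnL : n + 1 ≤ 2 ^ L := by
    have : (n : ℝ) + 1 ≤ 2 ^ L := le_trans (by rw [hZ]; nlinarith) hZL
    exact_mod_cast this
  have hnq : ((n * q : ℕ) : ℝ) ≤ 9 * Z * l := by
    push_cast
    calc (n : ℝ) * q ≤ n * (9 * (m * l)) := by
          gcongr
          exact hq9.trans (by gcongr)
      _ = _ := by rw [hZ]; ring
  have hnq4 : ((n * q : ℕ) : ℝ) < Z ^ 4 := by
    calc ((n * q : ℕ) : ℝ) ≤ 9 * Z * l := hnq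
      _ < 9 * Z * Z := by gcongr
      _ ≤ Z ^ 2 * Z * Z := by gcongr; nlinarith
      _ = Z ^ 4 := by ring
  have hN : ((n * q : ℕ) : ℝ) * Real.exp (-(4 * l)) < 1 := by
    rw [← hexp4, mul_comm]
    have := Real.exp_pos (-(4 * l))
    gcongr
  have hlog : Real.log (n * q : ℕ) ≤ 5 * l := by
    have h1 : (0 : ℝ) < (n * q : ℕ) := by exact_mod_cast Nat.mul_pos hn hq0
    have h2 := Real.log_le_log h1 hnq4.le
    rw [Real.log_pow] at h2
    push_cast at h2 ⊢
    linarith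
  obtain ⟨enc, henc⟩ := exists_encoding (N := n * q) (cap := bucketCap n q K) hmL hnL
  let s₀ : SketchState n m (n * q) (bucketCap n q K) :=
    ⟨fun _ => false, fun _ => ⟨0, hm0⟩, fun _ => ⟨∅, by simp⟩, ∅⟩
  have : Nonempty (SketchState n m (n * q) (bucketCap n q K)) := ⟨s₀⟩
  refine ⟨encoded enc (Function.invFun enc) (3 * r) s₀ SketchState.update
    (SketchState.finish q) SketchState.chosen, le_rfl, ?_, fun F hF σ hσ => ?_⟩
  · have h1 := workBits_le hε hε1 hl1 hX1 hn hq9 hq0 hK17 hL3 hlog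
    rw [StreamingAlgorithm.space]
    simpa only [encoded, zero_add] using h1
  rw [encoded_output _ _ (Function.leftInverse_invFun henc), PMF.toOuterMeasure_map_apply]
  -- The factor `2` makes `lam ^ r * m = 2 ^ (-r)` strictly less than one, so nothing stays
  -- unmarked.
  have hlam : (0 : ℝ) ≤ 1 / (2 * X) := by positivity
  have h₀ : Progress F ε (1 / (2 * X)) 0 s₀ := by
    refine ⟨by simp [s₀], by simp [s₀], ?_⟩
    simp [s₀, SketchState.unmarked]
  have hfail := passLaw_progress hε hε1 hn hm0 hF hl1 hK16 hN hσ hlam h₀ r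
  have hy : Real.exp (-(1 / (2 * X)) * q) * Z ^ 4 ≤ 1 := by
    refine le_trans ?_ hexp4.le
    gcongr
    have : 4 * l ≤ 1 / (2 * X) * q := by
      rw [one_div_mul_eq_div, le_div_iff₀ (by positivity)]
      linarith
    linarith
  have hrm2 : r ≤ m := by
    have : (r : ℝ) ≤ m := by linarith
    exact_mod_cast this
  refine (one_sub_le_toOuterMeasure _ _ _ (hfail.trans (failure_le hn hrm2 (by omega) hZ
    (Real.exp_pos _).le hy))).trans (MeasureTheory.measure_mono fun s hs => ?_)
  have hs' : Progress F ε (1 / (2 * X)) r s := hs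
  have hU : s.unmarked = ∅ := by
    have h1 : (s.unmarked.card : ℝ) < 1 := by
      refine hs'.unmarked.trans_lt ?_
      rw [div_pow, mul_pow, hXr, one_pow, one_div_mul_eq_div, div_lt_one (by positivity)]
      have : (1 : ℝ) < 2 ^ r := one_lt_pow₀ (by norm_num) (by omega)
      nlinarith
    rw [← Finset.card_eq_zero]
    have : s.unmarked.card < 1 := by exact_mod_cast h1
    omega
  refine ⟨fun e => (hs'.marks e).1 ?_, fun T hT => (hs'.card T hT).trans ?_⟩
  · by_contra hcon
    have : e ∈ s.unmarked := by simpa [SketchState.unmarked] using hcon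
    rw [hU] at this
    simp at this
  · calc (r : ℝ) * ((1 + ε) * T.card) ≤ Real.log m * ((1 + ε) * T.card) := by gcongr
      _ = _ := by ring

end EdgeArrival

theorem mainTheorem4 :
    ∃ (P : ℕ) (a : ℝ) (c : ℕ), ∀ ε : ℝ, 0 < ε → ε ≤ 1 → ∃ C : ℝ, 0 < C ∧
      ∀ n m r : ℕ, 1 ≤ r → (r : ℝ) ≤ Real.log (m : ℝ) →
        ∃ A : EdgeArrival.StreamingAlgorithm n m,
          A.passes ≤ P * r ∧
          (A.space : ℝ) ≤ C * ((n : ℝ) * (m : ℝ) ^ ((3 : ℝ) / (2 + (r : ℝ)))) *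
            Real.log ((n : ℝ) * (m : ℝ)) ^ c ∧
          (A.space : ℝ) ≤ C * ((n : ℝ) * (m : ℝ) ^ (a / (r : ℝ))) *
            Real.log ((n : ℝ) * (m : ℝ)) ^ c ∧
          ∀ F : Fin n → Finset (Fin m), (∀ e : Fin m, ∃ i : Fin n, e ∈ F i) →
            ∀ σ : List (EdgeArrival.Edge n m), EdgeArrival.IsEdgeStream F σ →
              1 - (n : ENNReal)⁻¹ ≤
                (A.output σ).toOuterMeasure
                  {S : Finset (Fin n) |
                    EdgeArrival.IsApproxSetCover ((1 + ε) * Real.log (m : ℝ)) F S} := by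
  refine ⟨3, 1, 4, fun ε hε hε1 => ⟨3000 / ε, by positivity, fun n m r hr hrm => ?_⟩⟩
  rcases Nat.eq_zero_or_pos n with rfl | hn
  -- For `n = 0` the required probability is `1 - 0⁻¹ = 1 - ⊤ = 0`.
  · refine ⟨EdgeArrival.trivialAlgorithm 0 m, Nat.zero_le _, ?_, ?_, fun F hF => ?_⟩
    · simp [EdgeArrival.trivialAlgorithm, EdgeArrival.StreamingAlgorithm.space]
    · simp [EdgeArrival.trivialAlgorithm, EdgeArrival.StreamingAlgorithm.space]
    · simp
  · obtain ⟨A, h1, h2, h3⟩ := EdgeArrival.exists_setCover_algorithm hε hε1 hn hr hrm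
    refine ⟨A, h1, h2.trans ?_, h2, h3⟩
    have hr' : (1 : ℝ) ≤ r := by exact_mod_cast hr
    have hm : (1 : ℝ) ≤ m := by
      rcases Nat.eq_zero_or_pos m with rfl | h
      · rw [Nat.cast_zero, Real.log_zero] at hrm
        linarith
      · exact_mod_cast h
    have hn' : (1 : ℝ) ≤ n := by exact_mod_cast hn
    have hlog : 0 ≤ Real.log ((n : ℝ) * m) :=
      Real.log_nonneg (one_le_mul_of_one_le_of_one_le hn' hm)
    gcongr 3000 / ε * (n * ?_) * _
    -- `1 / r ≤ 3 / (2 + r)` amounts to `1 ≤ r`.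
    refine Real.rpow_le_rpow_of_exponent_le hm ?_
    rw [div_le_div_iff₀ (by linarith) (by linarith)]
    linarith
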